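/- Let $d\ge 1$ be an integer. A convex body in $\mathbb{R}^d$ is a non-empty compact convex subset of $\mathbb{R}^d$ (not necessarily full-dimensional); let $\mathcal{K}^d$ be the set of all of them. For $K\in\mathcal{K}^d$ and $u\in\mathbb{R}^d$ put $\mathrm{w}(K,u)=\max_{x\in K}\langle u,x\rangle-\min_{x\in K}\langle u,x\rangle$, let $\mathrm{w}(K)=\inf_{u\in\mathbb{Z}^d\setminus\{0\}}\mathrm{w}(K,u)$ be the lattice width of $K$, and let $\mathrm{G}^\circ(K)=|\mathrm{int}(K)\cap\mathbb{Z}^d|$ be the number of interior lattice points of $K$. For an integer $k\ge 0$ let $\mathrm{Flt}(d,k)=\sup\{\mathrm{w}(K): K\in\mathcal{K}^d,\ \mathrm{G}^\circ(K)\le k\}$. Suprema are taken in the extended real line $[-\infty,\infty]$. (i) For all integers $0\le k\le \ell$, \[ \sup\{\mathrm{w}(K): K\in\mathcal{K}^d,\ \mathrm{G}^\circ(K)=k\}\ \le\ \sup\{\mathrm{w}(K): K\in\mathcal{K}^d,\ \mathrm{G}^\circ(K)=\ell\}. \] (ii) Consequently, for every integer $k\ge 0$, \[ \mathrm{Flt}(d,k)=\sup\{\mathrm{w}(K):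 K\in\mathcal{K}^d,\ \mathrm{G}^\circ(K)=k\}. \] -/

import Mathlib

noncomputable section

namespace LatticeWidth

/-- The standard Euclidean space `ℝ^d`. -/
abbrev Space (d : ℕ) : Type := EuclideanSpace ℝ (Fin d)

/-- The point of the lattice `ℤ^d ⊂ ℝ^d` with the given integer coordinates. -/
def latticePoint {d : ℕ} (z : Fin d → ℤ) : Space d :=
  WithLp.toLp 2 (fun i => (z i : ℝ))

/-- The integer lattice `ℤ^d` as a subset of `ℝ^d`. -/
def lattice (d : ℕ) : Set (Space d) := Set.range latticePoint

/-- The width `w(K, u) = max_{x ∈ K} ⟨u, x⟩ - min_{x ∈ K} ⟨u, x⟩` of a convex body in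
direction `u`. Since `K` is compact and nonempty, the supremum and infimum are attained. -/
def widthDir {d : ℕ} (K : ConvexBody (Space d)) (u : Space d) : ℝ :=
  sSup ((fun x => inner ℝ u x) '' (K : Set (Space d))) -
    sInf ((fun x => inner ℝ u x) '' (K : Set (Space d)))

/-- The lattice width `w(K) = inf_{u ∈ ℤ^d \ {0}} w(K, u)`. -/
def latticeWidth {d : ℕ} (K : ConvexBody (Space d)) : ℝ :=
  sInf ((fun u => widthDir K u) '' (lattice d \ {0}))

/-- The number of lattice points in the interior of `K`. -/
def interiorCount {d : ℕ} (K : ConvexBody (Space d)) : ℕ∞ :=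
  (interior (K : Set (Space d)) ∩ lattice d).encard

/-- `Flt(d, k)`: the supremum of the lattice width over all convex bodies in `ℝ^d` with at most
`k` interior lattice points, taken in the extended reals. -/
def flt (d k : ℕ) : EReal :=
  sSup {w : EReal | ∃ K : ConvexBody (Space d), interiorCount K ≤ (k : ℕ∞) ∧
    w = ((latticeWidth K : ℝ) : EReal)}

/-- The supremum of the lattice width over all convex bodies in `ℝ^d` with exactly `k` interior
lattice points, taken in the extended reals. -/
def fltExact (d k : ℕ) : EReal :=
  sSup {w : EReal | ∃ K : ConvexBody (Space d), interiorCount K = (k : ℕ∞) ∧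
    w = ((latticeWidth K : ℝ) : EReal)}

end LatticeWidth

end

namespace LatticeWidth

open Set Metric Filter Topology MeasureTheory

variable {d : ℕ}

/-! Lattice points are easy to add to a body one at a time if all of them are counted, boundary
included. So take `K` with `k` interior lattice points and `c < 1` near 1, and pass to a body of
width at least `c * latticeWidth K` with exactly `k` lattice points in total. Enlarge it by convex
hulls until it has `l`, then thicken it slightly so that these become interior and no others enter.
Enlarging never decreases the width, so `c → 1` gives (i). Part (ii) follows, since a count at most
`k` is some `j ≤ k`. -/

lemma inner_image_isCompact (K : ConvexBody (Space d)) (u : Space d) :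
    IsCompact ((fun x => inner ℝ u x) '' (K : Set (Space d))) :=
  K.isCompact.image (by fun_prop)

lemma inner_sub_le_widthDir (K : ConvexBody (Space d)) (u : Space d) {x y : Space d}
    (hx : x ∈ K) (hy : y ∈ K) : inner ℝ u (x - y) ≤ widthDir K u := by
  rw [inner_sub_right]
  exact sub_le_sub (le_csSup (inner_image_isCompact K u).bddAbove ⟨x, hx, rfl⟩)
    (csInf_le (inner_image_isCompact K u).bddBelow ⟨y, hy, rfl⟩)

lemma exists_widthDir_eq (K : ConvexBody (Space d)) (u : Space d) :
    ∃ x ∈ K, ∃ y ∈ K, widthDir K u = inner ℝ u (x - y) := by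
  obtain ⟨x, hx, hx'⟩ := (inner_image_isCompact K u).sSup_mem (K.nonempty.image _)
  obtain ⟨y, hy, hy'⟩ := (inner_image_isCompact K u).sInf_mem (K.nonempty.image _)
  refine ⟨x, hx, y, hy, ?_⟩
  rw [inner_sub_right, widthDir, ← hx', ← hy']

lemma widthDir_nonneg (K : ConvexBody (Space d)) (u : Space d) : 0 ≤ widthDir K u := by
  obtain ⟨x, hx⟩ := K.nonempty
  simpa using inner_sub_le_widthDir K u hx hx

lemma latticePoint_injective : Function.Injective (latticePoint (d := d)) := by
  intro z w h
  ext i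
  have := congrArg (fun v : Space d => v i) h
  simpa [latticePoint] using this

lemma lattice_diff_zero_nonempty (hd : 0 < d) : (lattice d \ {0}).Nonempty := by
  refine ⟨latticePoint (fun _ => 1), ⟨_, rfl⟩, fun h => ?_⟩
  have := congrArg (fun v : Space d => v ⟨0, hd⟩) (mem_singleton_iff.1 h)
  simp [latticePoint] at this

/-- If the difference body of `L` contains `c` times the difference body of `K`, then the
lattice width of `L` is at least `c` times that of `K`. -/
lemma mul_latticeWidth_le (hd : 0 < d) {K L : ConvexBody (Space d)} {c : ℝ} (hc : 0 ≤ c)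
    (h : ∀ x ∈ K, ∀ y ∈ K, ∃ x' ∈ L, ∃ y' ∈ L, x' - y' = c • (x - y)) :
    c * latticeWidth K ≤ latticeWidth L := by
  refine le_csInf ((lattice_diff_zero_nonempty hd).image _) ?_
  rintro _ ⟨u, hu, rfl⟩
  have h1 : latticeWidth K ≤ widthDir K u :=
    csInf_le ⟨0, by rintro _ ⟨v, -, rfl⟩; exact widthDir_nonneg K v⟩ ⟨u, hu, rfl⟩
  obtain ⟨x, hx, y, hy, hxy⟩ := exists_widthDir_eq K u
  obtain ⟨x', hx', y', hy', hxy'⟩ := h x hx y hy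
  calc c * latticeWidth K ≤ c * widthDir K u := mul_le_mul_of_nonneg_left h1 hc
    _ = inner ℝ u (x' - y') := by rw [hxy', inner_smul_right, hxy]
    _ ≤ widthDir L u := inner_sub_le_widthDir L u hx' hy'

lemma latticeWidth_mono (hd : 0 < d) {K L : ConvexBody (Space d)}
    (h : (K : Set (Space d)) ⊆ L) : latticeWidth K ≤ latticeWidth L := by
  simpa using mul_latticeWidth_le hd zero_le_one
    (fun x hx y hy => ⟨x, h hx, y, h hy, (one_smul ℝ _).symm⟩)

lemma finite_inter_lattice {s : Set (Space d)} (hs : Bornology.IsBounded s) :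
    (s ∩ lattice d).Finite := by
  obtain ⟨R, hR⟩ := hs.exists_norm_le
  refine ((Set.finite_Icc (fun _ : Fin d => -⌈R⌉) (fun _ => ⌈R⌉)).image latticePoint).subset ?_
  rintro _ ⟨hz, z, rfl⟩
  have key : ∀ i, |(z i : ℝ)| ≤ ⌈R⌉ := fun i =>
    calc |(z i : ℝ)| = ‖(latticePoint z) i‖ := rfl
      _ ≤ ‖latticePoint z‖ := PiLp.norm_apply_le _ i
      _ ≤ R := hR _ hz
      _ ≤ ⌈R⌉ := Int.le_ceil R
  refine ⟨z, ⟨fun i => ?_, fun i => ?_⟩, rfl⟩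
  · exact_mod_cast (abs_le.1 (key i)).1
  · exact_mod_cast (abs_le.1 (key i)).2

lemma exists_lattice_notMem (hd : 0 < d) {s : Set (Space d)} (hs : Bornology.IsBounded s) :
    ∃ p ∈ lattice d, p ∉ s := by
  by_contra! h
  have hfin := finite_inter_lattice hs
  rw [inter_eq_right.2 h] at hfin
  have : Nonempty (Fin d) := ⟨⟨0, hd⟩⟩
  exact Set.infinite_range_of_injective latticePoint_injective hfin

lemma lattice_countable : (lattice d).Countable := countable_range _

/-! ### Adding lattice points one at a time -/

/-- The convex hull of a convex body and a point. -/
def hullInsert (p : Space d) (K : ConvexBody (Space d)) : ConvexBody (Space d) where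
  carrier := convexHull ℝ (insert p (K : Set (Space d)))
  convex' := convex_convexHull ℝ _
  isCompact' := by
    have h : convexHull ℝ (insert p (K : Set (Space d))) =
        (fun a : ℝ × Space d => a.1 • p + (1 - a.1) • a.2) '' (Icc 0 1 ×ˢ (K : Set (Space d))) := by
      ext z
      simp only [convexHull_insert K.nonempty, K.convex.convexHull_eq, mem_convexJoin, segment,
        mem_singleton_iff, exists_eq_left, mem_image, mem_prod, Prod.exists]
      constructor
      · rintro ⟨x, hx, a, b, ha, hb, hab, rfl⟩
        exact ⟨a, x, ⟨⟨ha, by linarith⟩, hx⟩, by rw [← hab]; simp⟩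
      · rintro ⟨a, x, ⟨ha, hx⟩, rfl⟩
        exact ⟨x, hx, a, 1 - a, ha.1, sub_nonneg.2 ha.2, by ring, rfl⟩
    rw [h]
    exact (isCompact_Icc.prod K.isCompact).image (by fun_prop)
  nonempty' := ⟨p, subset_convexHull ℝ _ (mem_insert _ _)⟩

lemma mem_hullInsert {p z : Space d} {K : ConvexBody (Space d)} :
    z ∈ hullInsert p K ↔ ∃ x ∈ K, ∃ a b : ℝ, 0 ≤ a ∧ 0 ≤ b ∧ a + b = 1 ∧ a • p + b • x = z := by
  change z ∈ convexHull ℝ (insert p (K : Set (Space d))) ↔ _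
  simp only [convexHull_insert K.nonempty, K.convex.convexHull_eq, mem_convexJoin, segment,
    mem_singleton_iff, exists_eq_left, mem_ofPred_eq, SetLike.mem_coe]

lemma self_mem_hullInsert (p : Space d) (K : ConvexBody (Space d)) : p ∈ hullInsert p K :=
  subset_convexHull ℝ (insert p (K : Set (Space d))) (mem_insert _ _)

lemma subset_hullInsert (p : Space d) (K : ConvexBody (Space d)) :
    (K : Set (Space d)) ⊆ hullInsert p K :=
  (subset_insert _ _).trans (subset_convexHull ℝ (insert p (K : Set (Space d))))

lemma hullInsert_subset {p q : Space d} {K : ConvexBody (Space d)} (hq : q ∈ hullInsert p K) :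
    (hullInsert q K : Set (Space d)) ⊆ hullInsert p K :=
  convexHull_min (insert_subset hq (subset_hullInsert p K)) (hullInsert p K).convex

/-- The convex hull operator satisfies the anti-exchange property. -/
lemma notMem_hullInsert {p q : Space d} {K : ConvexBody (Space d)} (hp : p ∉ K) (hqp : q ≠ p)
    (hq : q ∈ hullInsert p K) : p ∉ hullInsert q K := by
  intro hpq
  obtain ⟨x, hx, a, b, ha, hb, hab, rfl⟩ := mem_hullInsert.1 hq
  obtain ⟨y, hy, s, t, hs, ht, hst, h⟩ := mem_hullInsert.1 hpq
  have hb' : 0 < b := by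
    refine lt_of_le_of_ne hb fun h0 => hqp ?_
    subst h0
    obtain rfl : a = 1 := by linarith
    simp
  -- Solving `p = s • (a • p + b • x) + t • y` for `p` makes it a convex combination of `x, y ∈ K`
  -- with weights proportional to `s * b` and `t`.
  have hpos : 0 < s * b + t := by
    rcases ht.eq_or_lt with h0 | h0
    · obtain rfl : s = 1 := by linarith
      linarith
    · positivity
  refine hp ?_
  have hy' := K.convex hx hy (a := (s * b) / (s * b + t)) (b := t / (s * b + t))
    (by positivity) (by positivity) (by field_simp)
  have h2 : (s * b + t) • p = (s * b) • x + t • y := by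
    have e : s * b + t = 1 - s * a := by
      have : a = 1 - b := by linarith
      rw [this]; linarith
    rw [e, sub_smul, one_smul]
    nth_rewrite 1 [← h]
    module
  rwa [div_eq_inv_mul, div_eq_inv_mul, mul_smul, mul_smul _ t, ← smul_add, ← h2, smul_smul,
    inv_mul_cancel₀ hpos.ne', one_smul] at hy'

/-- A convex body can be enlarged so as to contain exactly one more lattice point. -/
lemma exists_encard_add_one (hd : 0 < d) (K : ConvexBody (Space d)) :
    ∃ L : ConvexBody (Space d), (K : Set (Space d)) ⊆ L ∧
      ((L : Set (Space d)) ∩ lattice d).encard = ((K : Set (Space d)) ∩ lattice d).encard + 1 := by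
  -- Choose `p` outside `K` whose hull with `K` has fewest lattice points. Another new lattice point
  -- `q` in it would, by anti-exchange, span a hull missing `p`, contradicting minimality.
  obtain ⟨p, ⟨hpl, hpK⟩, hmin⟩ := exists_minimalFor_of_wellFoundedLT
    (fun p => p ∈ lattice d ∧ p ∉ (K : Set (Space d)))
    (fun p => ((hullInsert p K : Set (Space d)) ∩ lattice d).ncard)
    (exists_lattice_notMem hd K.isCompact.isBounded)
  refine ⟨hullInsert p K, subset_hullInsert p K, ?_⟩
  have h : (hullInsert p K : Set (Space d)) ∩ lattice d =
      insert p ((K : Set (Space d)) ∩ lattice d) := by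
    apply Subset.antisymm
    · rintro q ⟨hq, hql⟩
      by_contra hne
      simp only [mem_insert_iff, mem_inter_iff, not_or] at hne
      have hqK : q ∉ (K : Set (Space d)) := fun h => hne.2 ⟨h, hql⟩
      have hlt := ncard_lt_ncard (s := (hullInsert q K : Set (Space d)) ∩ lattice d)
        (t := (hullInsert p K : Set (Space d)) ∩ lattice d)
        ((ssubset_iff_of_subset (inter_subset_inter_left _ (hullInsert_subset hq))).2
          ⟨p, ⟨self_mem_hullInsert p K, hpl⟩,
            fun hp => notMem_hullInsert hpK hne.1 hq hp.1⟩)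
        (finite_inter_lattice (hullInsert p K).isCompact.isBounded)
      exact absurd (hmin ⟨hql, hqK⟩ hlt.le) (not_le.2 hlt)
    · exact insert_subset ⟨self_mem_hullInsert p K, hpl⟩
        (inter_subset_inter_left _ (subset_hullInsert p K))
  rw [h, encard_insert_of_notMem fun hp => hpK hp.1]

lemma exists_encard_add (hd : 0 < d) (K : ConvexBody (Space d)) (n : ℕ) :
    ∃ L : ConvexBody (Space d), (K : Set (Space d)) ⊆ L ∧
      ((L : Set (Space d)) ∩ lattice d).encard = ((K : Set (Space d)) ∩ lattice d).encard + n := by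
  induction n with
  | zero => exact ⟨K, Subset.rfl, by simp⟩
  | succ n ih =>
    obtain ⟨L, hKL, hL⟩ := ih
    obtain ⟨M, hLM, hM⟩ := exists_encard_add_one hd L
    exact ⟨M, hKL.trans hLM, by rw [hM, hL]; push_cast; ring⟩

/-! ### Trading interior lattice points for all lattice points -/

/-- A convex body can be enlarged so that its lattice points become the interior ones. -/
lemma exists_interiorCount_eq_encard (K : ConvexBody (Space d)) :
    ∃ L : ConvexBody (Space d), (K : Set (Space d)) ⊆ L ∧
      interiorCount L = ((K : Set (Space d)) ∩ lattice d).encard := by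
  obtain ⟨R, hR⟩ := K.isCompact.isBounded.subset_ball (0 : Space d)
  -- The open set is a ball around `K` minus its finitely many lattice points outside `K`.
  obtain ⟨δ, hδ, hsub⟩ := K.isCompact.exists_cthickening_subset_open
    (t := ball (0 : Space d) R ∩ ((ball (0 : Space d) R ∩ lattice d) \ K)ᶜ)
    (isOpen_ball.inter ((finite_inter_lattice isBounded_ball).sdiff.isClosed.isOpen_compl))
    (fun x hx => ⟨hR hx, fun h => h.2 hx⟩)
  have hint : (K : Set (Space d)) ⊆ interior (cthickening δ (K : Set (Space d))) :=
    (self_subset_thickening hδ _).trans (thickening_subset_interior_cthickening _ _)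
  refine ⟨⟨cthickening δ (K : Set (Space d)), K.convex.cthickening δ, K.isCompact.cthickening,
    K.nonempty.mono (self_subset_cthickening _)⟩, self_subset_cthickening _, ?_⟩
  refine congrArg encard (Subset.antisymm ?_ (inter_subset_inter_left _ hint))
  rintro z ⟨hz, hzl⟩
  obtain ⟨h1, h2⟩ := hsub (interior_subset hz)
  exact ⟨by_contra fun hzK => h2 ⟨⟨h1, hzl⟩, hzK⟩, hzl⟩

/-- The image of a convex body under the map `x ↦ v + c • x`. -/
def smulTranslate (c : ℝ) (v : Space d) (K : ConvexBody (Space d)) : ConvexBody (Space d) where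
  carrier := (fun x => v + c • x) '' (K : Set (Space d))
  convex' := by
    have := (K.convex.smul c).translate v
    rwa [← image_smul, image_image] at this
  isCompact' := K.isCompact.image (by fun_prop)
  nonempty' := K.nonempty.image _

lemma mul_latticeWidth_le_smulTranslate (hd : 0 < d) {c : ℝ} (hc : 0 ≤ c) (v : Space d)
    (K : ConvexBody (Space d)) : c * latticeWidth K ≤ latticeWidth (smulTranslate c v K) :=
  mul_latticeWidth_le hd hc fun x hx y hy =>
    ⟨v + c • x, ⟨x, hx, rfl⟩, v + c • y, ⟨y, hy, rfl⟩, by module⟩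

/-- A convex body without interior is Lebesgue-null, so the translations that make it hit the
lattice form a countable union of null sets. -/
lemma exists_translate_disjoint_lattice {K : ConvexBody (Space d)}
    (hK : interior (K : Set (Space d)) = ∅) :
    ∃ v : Space d, (smulTranslate 1 v K : Set (Space d)) ∩ lattice d = ∅ := by
  have h0 : volume (K : Set (Space d)) = 0 := by
    have := K.convex.addHaar_frontier volume
    rwa [K.isClosed.frontier_eq, hK, sdiff_empty] at this
  have h1 : volume (⋃ z ∈ lattice d, (fun v : Space d => z - v) ⁻¹' (K : Set (Space d))) = 0 := by
    refine (measure_biUnion_null_iff lattice_countable).2 fun z _ => ?_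
    rw [(Measure.measurePreserving_sub_left volume z).measure_preimage
      K.isClosed.measurableSet.nullMeasurableSet, h0]
  obtain ⟨v, hv⟩ : ∃ v, v ∉ ⋃ z ∈ lattice d, (fun v : Space d => z - v) ⁻¹' (K : Set (Space d)) := by
    by_contra! h
    rw [eq_univ_of_forall h] at h1
    exact (NeZero.ne (volume : Measure (Space d))) (Measure.measure_univ_eq_zero.1 h1)
  refine ⟨v, eq_empty_of_forall_notMem ?_⟩
  rintro _ ⟨⟨x, hx, rfl⟩, hl⟩
  refine hv (mem_biUnion hl ?_)
  simpa using hx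

/-- Shrinking towards an interior point `x` pushes `K` into its own interior, and for `c` near 1 the
finitely many interior lattice points survive. If there is no interior, a translate off the lattice
serves for every `c`. -/
lemma eventually_exists_encard_eq_interiorCount (hd : 0 < d) (K : ConvexBody (Space d)) :
    ∀ᶠ c in 𝓝[<] (1 : ℝ), ∃ L : ConvexBody (Space d), c * latticeWidth K ≤ latticeWidth L ∧
      ((L : Set (Space d)) ∩ lattice d).encard = interiorCount K := by
  have hIoo : ∀ᶠ c in 𝓝[<] (1 : ℝ), c ∈ Ioo (0 : ℝ) 1 := Ioo_mem_nhdsLT zero_lt_one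
  rcases (interior (K : Set (Space d))).eq_empty_or_nonempty with hK | ⟨x, hx⟩
  · obtain ⟨v, hv⟩ := exists_translate_disjoint_lattice hK
    filter_upwards [hIoo] with c hc
    refine ⟨smulTranslate 1 v K, ?_, by simp [hv, interiorCount, hK]⟩
    have h1 := mul_latticeWidth_le_smulTranslate hd zero_le_one v K
    have h2 : 0 ≤ latticeWidth K :=
      Real.sInf_nonneg (by rintro _ ⟨u, -, rfl⟩; exact widthDir_nonneg K u)
    nlinarith [hc.2]
  · have hfin : (interior (K : Set (Space d)) ∩ lattice d).Finite :=
      finite_inter_lattice (K.isCompact.isBounded.subset interior_subset)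
    -- `x + c⁻¹ • (z - x)` is the preimage of `z` under the shrinking.
    have hmem : ∀ᶠ c in 𝓝[<] (1 : ℝ), ∀ z ∈ interior (K : Set (Space d)) ∩ lattice d,
        x + c⁻¹ • (z - x) ∈ interior (K : Set (Space d)) := by
      refine (eventually_all_finite hfin).2 fun z hz => ?_
      have ht : Tendsto (fun c : ℝ => x + c⁻¹ • (z - x)) (𝓝 1) (𝓝 z) := by
        have : ContinuousAt (fun c : ℝ => x + c⁻¹ • (z - x)) 1 :=
          continuousAt_const.add ((continuousAt_inv₀ one_ne_zero).smul continuousAt_const)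
        simpa [ContinuousAt] using this
      exact (ht.mono_left nhdsWithin_le_nhds).eventually (isOpen_interior.mem_nhds hz.1)
    filter_upwards [hIoo, hmem] with c hc hcm
    refine ⟨smulTranslate c ((1 - c) • x) K, mul_latticeWidth_le_smulTranslate hd hc.1.le _ K,
      congrArg encard (Subset.antisymm ?_ ?_)⟩
    · rintro _ ⟨⟨y, hy, rfl⟩, hl⟩
      exact ⟨K.convex.combo_interior_self_mem_interior hx hy (sub_pos.2 hc.2) hc.1.le (by ring), hl⟩
    · intro z hz
      refine ⟨⟨x + c⁻¹ • (z - x), interior_subset (hcm z hz), ?_⟩, hz.2⟩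
      simp only [smul_add, smul_smul, mul_inv_cancel₀ hc.1.ne']
      module

/-- The supremum of the lattice width over all bodies with exactly `k` interior lattice points is
monotone in `k`. -/
lemma fltExact_mono (hd : 0 < d) {k l : ℕ} (hkl : k ≤ l) : fltExact d k ≤ fltExact d l := by
  refine sSup_le ?_
  rintro _ ⟨K, hK, rfl⟩
  have ht : Tendsto (fun c : ℝ => ((c * latticeWidth K : ℝ) : EReal)) (𝓝[<] 1)
      (𝓝 (latticeWidth K : EReal)) := by
    have : Continuous fun c : ℝ => ((c * latticeWidth K : ℝ) : EReal) :=
      continuous_coe_real_ereal.comp (by fun_prop)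
    simpa using (this.tendsto 1).mono_left (nhdsWithin_le_nhds (s := Iio 1))
  refine le_of_tendsto ht ?_
  filter_upwards [eventually_exists_encard_eq_interiorCount hd K] with c ⟨L, hL, hLc⟩
  obtain ⟨M, hLM, hM⟩ := exists_encard_add hd L (l - k)
  obtain ⟨N, hMN, hN⟩ := exists_interiorCount_eq_encard M
  refine le_trans (EReal.coe_le_coe_iff.2 (hL.trans (latticeWidth_mono hd (hLM.trans hMN))))
    (le_sSup ⟨N, ?_, rfl⟩)
  rw [hN, hM, hLc, hK, ← Nat.cast_add, Nat.add_sub_cancel' hkl]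

lemma flt_eq_fltExact (hd : 0 < d) (k : ℕ) : flt d k = fltExact d k := by
  apply le_antisymm
  · refine sSup_le ?_
    rintro _ ⟨K, hK, rfl⟩
    obtain ⟨j, hj⟩ := ENat.ne_top_iff_exists.1 (ne_top_of_le_ne_top (ENat.natCast_ne_top k) hK)
    rw [← hj, Nat.cast_le] at hK
    refine le_trans ?_ (fltExact_mono hd hK)
    exact le_sSup ⟨K, hj.symm, rfl⟩
  · refine sSup_le ?_
    rintro _ ⟨K, hK, rfl⟩
    exact le_sSup ⟨K, hK.le, rfl⟩

end LatticeWidth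

theorem mainTheorem11 (d : ℕ) (hd : 0 < d) :
    (∀ k l : ℕ, k ≤ l → LatticeWidth.fltExact d k ≤ LatticeWidth.fltExact d l) ∧
    (∀ k : ℕ, LatticeWidth.flt d k = LatticeWidth.fltExact d k) :=
  ⟨fun _ _ h => LatticeWidth.fltExact_mono hd h, fun k => LatticeWidth.flt_eq_fltExact hd k⟩
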